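/- For a finite graph $H$ with at least one vertex, let $|H|$ be its number of vertices and let $\pi(H)$ be the maximum number of edges of a spanning linear forest of $H$ (a forest is linear if its components are paths). Let $P_{2k+1}$ be the path with $2k+1$ vertices, $k\geq 1$. The lexicographic product $P_{2k+1}[H]$ has vertex set $V(P_{2k+1})\times V(H)$, and $(g,h)$, $(g',h')$ are adjacent if and only if $gg'\in E(P_{2k+1})$, or $g=g'$ and $hh'\in E(H)$. A graph is traceable if it contains a hamiltonian path, i.e. a path through all of its vertices. Then $P_{2k+1}[H]$ is traceable if and only if $(k+1)\,\pi(H)\geq |H|-1$. In particular, if $\pi(H)\geq 1$, then $P_{2k+1}[H]$ is traceable if and only if $\left\lceil\frac{|H|-1}{\pi(H)}\right\rceil\leq k+1$. -/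

import Mathlib

namespace SimpleGraph

/-- The lexicographic product `G[H]`: vertex set `V(G) × V(H)`, and `(g, h)` is adjacent to
`(g', h')` when `gg'` is an edge of `G`, or `g = g'` and `hh'` is an edge of `H`. -/
def lexProduct {V W : Type*} (G : SimpleGraph V) (H : SimpleGraph W) : SimpleGraph (V × W) where
  Adj x y := G.Adj x.1 y.1 ∨ (x.1 = y.1 ∧ H.Adj x.2 y.2)
  symm := ⟨fun _ _ h => h.imp (fun h => h.symm) (fun h => ⟨h.1.symm, h.2.symm⟩)⟩
  loopless := ⟨fun _ h => h.elim (fun h => h.ne rfl) (fun h => h.2.ne rfl)⟩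

/-- A graph is traceable if it contains a hamiltonian path. -/
def IsTraceable {V : Type*} [DecidableEq V] (G : SimpleGraph V) : Prop :=
  ∃ (u v : V) (p : G.Walk u v), p.IsHamiltonian

/-- A linear forest: a forest all of whose components are paths. -/
def IsLinearForest {V : Type*} (F : SimpleGraph V) : Prop :=
  F.IsAcyclic ∧ ∀ c : F.ConnectedComponent, ∃ n : ℕ, Nonempty (c.toSimpleGraph ≃g pathGraph n)

/-- `π(H)`: the maximum number of edges of a spanning linear forest of the (finite) graph `H`.
A spanning subgraph of `H` is a graph `F ≤ H` on the same vertex type. -/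
noncomputable def maxLinearForest {V : Type*} (H : SimpleGraph V) : ℕ :=
  sSup {m : ℕ | ∃ F : SimpleGraph V, F ≤ H ∧ F.IsLinearForest ∧ F.edgeSet.ncard = m}

end SimpleGraph

open Finset

/-! Write `n = |H|` and number the columns `0, …, 2k`. Necessity: a hamiltonian path has `(2k+1)n -
1` steps, at most `2kn` of which meet the `kn` vertices of odd columns. The other steps, at least `n
- 1`, stay inside the `k + 1` even columns, and in each of these they form a linear forest of `H`
(`isLinearForest_of_consecutive`).

Sufficiency: a maximum linear forest cuts `H` into at most `n - π(H)` paths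
(`IsLinearForest.exists_chains`). The hypothesis is what allows the even columns to be cut into `kn
+ 1` path blocks in all, each column into at most `n`. The `kn` vertices of odd columns then
separate the blocks; with both kinds in column order, each separator is in a column next to those of
its two blocks. -/

/-! ### Lists and sums: cutting, alternating and counting blocks. -/

theorem List.exists_refinement {α : Type*} {R : α → α → Prop} (L : List (List α)) (hne : [] ∉ L)
    (hch : ∀ l ∈ L, l.IsChain R) {c : ℕ} (h1 : L.length ≤ c) (h2 : c ≤ L.flatten.length) :
    ∃ L' : List (List α), [] ∉ L' ∧ (∀ l ∈ L', l.IsChain R) ∧ L'.flatten = L.flatten ∧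
      L'.length = c := by
  induction c, h1 using Nat.le_induction with
  | base => exact ⟨L, hne, hch, rfl, rfl⟩
  | succ c hc ih =>
    obtain ⟨L', hne', hch', hfl, hlen⟩ := ih (by omega)
    have : ∃ l ∈ L', 1 < l.length := by
      by_contra! h
      have := List.sum_le_card_nsmul (L'.map List.length) 1 (by simpa using h)
      rw [← List.length_flatten, hfl] at this
      simp at this
      simp at h2
      omega
    obtain ⟨l, hl, hl1⟩ := this
    obtain ⟨s, t, rfl⟩ := List.append_of_mem hl
    match l, hl1 with
    | x :: y :: l, _ =>
      -- Cutting the first vertex off a block of length at least two adds exactly one block.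
      refine ⟨s ++ [x] :: (y :: l) :: t, ?_, ?_, ?_, ?_⟩
      · simp at hne' ⊢; exact hne'
      · intro m hm
        have := hch' (x :: y :: l) (by simp)
        rw [List.isChain_cons_cons] at this
        simp only [List.mem_append, List.mem_cons] at hm
        rcases hm with hm | rfl | rfl | hm
        · exact hch' m (by simp [hm])
        · simp
        · exact this.2
        · exact hch' m (by simp [hm])
      · rw [← hfl]; simp
      · rw [← hlen]; simp; omega

/-- Blocks `es` and separators `os` can be alternated into a single chain. -/
theorem List.exists_isChain_perm_flatten_append {α : Type*} {R : α → α → Prop} (os : List α)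
    (es : List (List α)) (hlen : es.length = os.length + 1) (hch : ∀ e ∈ es, e.IsChain R)
    (hne : [] ∉ es)
    (h1 : ∀ (m : ℕ) (ho : m < os.length) (he : m < es.length), ∀ x ∈ es[m], R x os[m])
    (h2 : ∀ (m : ℕ) (ho : m < os.length) (he : m + 1 < es.length), ∀ x ∈ es[m + 1], R os[m] x) :
    ∃ l : List α, l.Perm (es.flatten ++ os) ∧ l.IsChain R ∧
      ∀ x ∈ l.head?, ∀ e ∈ es.head?, x ∈ e := by
  induction os generalizing es with
  | nil =>
    match es, hlen with
    | [e], _ =>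
      exact ⟨e, by simp, hch e (by simp), by simpa using fun x hx => List.mem_of_mem_head? hx⟩
  | cons o os ih =>
    match es, hlen with
    | e :: es, hlen =>
      simp only [List.length_cons, Nat.add_right_cancel_iff] at hlen
      -- `hh` places the head of the tail chain in its first block, so that `h2` applies at the
      -- junction with `o`.
      obtain ⟨l, hp, hc, hh⟩ := ih es hlen (fun e he => hch e (by simp [he]))
        (fun h => hne (by simp [h]))
        (fun m ho he => h1 (m + 1) (by simpa using ho) (by simpa using he))
        (fun m ho he => h2 (m + 1) (by simpa using ho) (by simpa using he))
      refine ⟨e ++ o :: l, ?_, ?_, ?_⟩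
      · simp only [List.flatten_cons, List.append_assoc]
        exact ((hp.cons o).trans List.perm_middle.symm).append_left e
      · rw [List.isChain_append, List.isChain_cons]
        refine ⟨hch e (by simp), ⟨?_, hc⟩, ?_⟩
        · intro y hy
          match es, hlen with
          | e' :: es, hlen =>
            exact h2 0 (by simp) (by simp) y (hh y hy e' (by simp))
        · intro x hx y hy
          simp only [List.head?_cons, Option.mem_def, Option.some.injEq] at hy
          subst hy
          exact h1 0 (by simp) (by simp) x (List.mem_of_mem_getLast? hx)
      · have : e ≠ [] := fun h => hne (by simp [h])
        intro x hx e' he'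
        simp only [List.head?_cons, Option.mem_def, Option.some.injEq] at he'
        subst he'
        match e, this with
        | a :: e, _ => simp at hx; simp [hx]

theorem List.getElem_flatMap_range {α : Type*} (f : ℕ → List α) (K m : ℕ)
    (h : m < ((List.range K).flatMap f).length) :
    ∃ i < K, ((List.range K).flatMap f)[m] ∈ f i ∧ ∑ j ∈ Finset.range i, (f j).length ≤ m ∧
      m < ∑ j ∈ Finset.range (i + 1), (f j).length := by
  have hlen : ∀ K, ((List.range K).flatMap f).length = ∑ j ∈ Finset.range K, (f j).length := by
    intro K
    induction K with
    | zero => simp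
    | succ K ih => rw [Finset.sum_range_succ, ← ih, List.range_succ]; simp
  induction K with
  | zero => simp at h
  | succ K ih =>
    have heq : (List.range (K + 1)).flatMap f = (List.range K).flatMap f ++ f K := by
      rw [List.range_succ]; simp
    simp only [heq] at h ⊢
    by_cases hm : m < ((List.range K).flatMap f).length
    · obtain ⟨i, hi, h1, h2⟩ := ih hm
      exact ⟨i, by omega, by rwa [List.getElem_append_left hm], h2⟩
    · refine ⟨K, by omega, ?_, by rw [← hlen]; omega, ?_⟩
      · rw [List.getElem_append_right (by omega)]
        exact List.getElem_mem _
      · rw [Finset.sum_range_succ, ← hlen]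
        simpa using h

/-- Chooses the number of blocks in each even column; the last term is taken as large as possible
while leaving `p` for each of the others. -/
theorem Nat.exists_sum_range_eq {K s p n : ℕ} (h1 : K * p ≤ s) (h2 : s ≤ K * n) (hpn : p ≤ n) :
    ∃ c : ℕ → ℕ, (∀ i, p ≤ c i ∧ c i ≤ n) ∧ ∑ i ∈ Finset.range K, c i = s := by
  induction K generalizing s with
  | zero => exact ⟨fun _ => p, by simpa using hpn, by simp at h2 ⊢; omega⟩
  | succ K ih =>
    have hK : K * p ≤ K * n := Nat.mul_le_mul_left _ hpn
    rw [Nat.succ_mul] at h1 h2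
    obtain ⟨c, hc, hs⟩ := @ih (s - min n (s - K * p)) (by omega) (by omega)
    refine ⟨fun i => if i = K then min n (s - K * p) else c i, fun i => ?_, ?_⟩
    · simp only
      split_ifs
      · omega
      · exact hc i
    · rw [Finset.sum_range_succ, if_pos rfl, Finset.sum_congr rfl (g := c), hs]
      · omega
      · intro i hi
        rw [if_neg (by simp at hi; omega)]
-- Linear forests.
namespace SimpleGraph
variable {V : Type*}

/-- A discrete intermediate value theorem: levels change by one along edges, so a walk cannot skip a
level. -/
theorem exists_adj_crossing {F : SimpleGraph V} {f : V → ℕ}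
    (hadj : ∀ u v, F.Adj u v → f v = f u + 1 ∨ f u = f v + 1) {x y : V} (h : F.Reachable x y)
    {m : ℕ} (hx : f x ≤ m) (hy : m < f y) : ∃ a b, F.Adj a b ∧ F.Reachable x a ∧ f a = m ∧ f b = m + 1 := by
  obtain ⟨p⟩ := h
  obtain ⟨d, hd, h1, h2⟩ := p.exists_boundary_dart {v | f v ≤ m} hx (by simpa using hy)
  have h1' : f d.fst ≤ m := h1
  have h2' : ¬ f d.snd ≤ m := h2
  have := hadj _ _ d.adj
  refine ⟨d.fst, d.snd, d.adj, ?_, by omega, by omega⟩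
  classical
  exact ⟨p.takeUntil _ (p.dart_fst_mem_support_of_mem_darts hd)⟩

/-- If the vertices are injectively numbered so that edges join consecutive numbers, then the
graph is a linear forest. -/
theorem isLinearForest_of_consecutive [Finite V] {F : SimpleGraph V} {f : V → ℕ}
    (hf : Function.Injective f) (hadj : ∀ u v, F.Adj u v → f v = f u + 1 ∨ f u = f v + 1) :
    F.IsLinearForest := by
  refine ⟨?_, fun c => ?_⟩
  · rw [isAcyclic_iff_forall_adj_isBridge]
    have key : ∀ u v, F.Adj u v → f v = f u + 1 → F.IsBridge s(u, v) := by
      intro u v huv h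
      rw [isBridge_iff]
      intro hr
      -- By injectivity only `uv` joins these two levels, and it has been deleted.
      obtain ⟨a, b, hab, -, ha, hb⟩ := exists_adj_crossing
        (fun x y hxy => hadj x y (deleteEdges_le _ hxy)) hr (m := f u) le_rfl (by omega)
      obtain rfl := hf ha
      obtain rfl : b = v := hf (by omega)
      simp at hab
    intro u v huv
    rcases hadj u v huv with h | h
    · exact key u v huv h
    · rw [Sym2.eq_swap]; exact key v u huv.symm h
  · obtain ⟨x, hx, hmin⟩ := Set.exists_min_image c.supp f (Set.toFinite _) c.nonempty_supp
    obtain ⟨y, hy, hmax⟩ := Set.exists_max_image c.supp f (Set.toFinite _) c.nonempty_supp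
    have hreach : ∀ {u v}, u ∈ c.supp → v ∈ c.supp → F.Reachable u v := fun hu hv =>
      ConnectedComponent.exact (hu.trans hv.symm)
    -- The numbers in a component fill the interval from `f x` to `f y`.
    refine ⟨f y - f x + 1, ⟨⟨Equiv.ofBijective
      (fun v => ⟨f v.1 - f x, by have := hmax v.1 v.2; omega⟩) ⟨?_, ?_⟩, ?_⟩⟩⟩
    · intro u v h
      have h' : f u.1 - f x = f v.1 - f x := congrArg Fin.val h
      have := hmin u.1 u.2
      have := hmin v.1 v.2
      exact Subtype.ext (hf (by omega))
    · rintro ⟨i, hi⟩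
      rcases Nat.lt_or_ge (f x + i) (f y) with h | h
      · obtain ⟨a, b, -, hr, ha, -⟩ := exists_adj_crossing hadj (hreach hx hy) (by omega) h
        exact ⟨⟨a, (ConnectedComponent.sound hr).symm.trans hx⟩, by ext; simp; omega⟩
      · exact ⟨⟨y, hy⟩, by ext; have := hmin y hy; simp; omega⟩
    · intro u v
      have hu := hmin u.1 u.2
      have hv := hmin v.1 v.2
      have key : ∀ u v : V, u ∈ c.supp → v ∈ c.supp → f v = f u + 1 → F.Adj u v := by
        intro u v hu hv h
        obtain ⟨a, b, hab, -, ha, hb⟩ := exists_adj_crossing hadj (hreach hu hv) le_rfl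
          (by omega)
        obtain rfl := hf ha
        obtain rfl : b = v := hf (by omega)
        exact hab
      have : c.toSimpleGraph.Adj u v ↔ F.Adj u.1 v.1 := Iff.rfl
      rw [this, pathGraph_adj]
      change f u.1 - f x + 1 = f v.1 - f x ∨ f v.1 - f x + 1 = f u.1 - f x ↔ _
      constructor
      · rintro (h | h)
        · exact key _ _ u.2 v.2 (by omega)
        · exact (key _ _ v.2 u.2 (by omega)).symm
      · intro h
        have := hadj _ _ h
        omega

theorem bddAbove_linearForest_card [Finite V] (H : SimpleGraph V) :
    BddAbove {m : ℕ | ∃ F : SimpleGraph V, F ≤ H ∧ F.IsLinearForest ∧ F.edgeSet.ncard = m} := by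
  refine ⟨H.edgeSet.ncard, ?_⟩
  rintro m ⟨F, hF, -, rfl⟩
  exact Set.ncard_le_ncard (edgeSet_mono hF)

theorem IsLinearForest.ncard_le [Finite V] {H F : SimpleGraph V} (hF : F.IsLinearForest)
    (hle : F ≤ H) : F.edgeSet.ncard ≤ H.maxLinearForest :=
  le_csSup H.bddAbove_linearForest_card ⟨F, hle, hF, rfl⟩

theorem exists_isLinearForest_ncard_eq [Finite V] (H : SimpleGraph V) :
    ∃ F : SimpleGraph V, F ≤ H ∧ F.IsLinearForest ∧ F.edgeSet.ncard = H.maxLinearForest := by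
  have := Nat.sSup_mem ?_ H.bddAbove_linearForest_card
  · exact this
  · obtain ⟨n, ⟨e⟩⟩ := Finite.exists_equiv_fin V
    exact ⟨_, ⊥, bot_le, isLinearForest_of_consecutive (f := fun v => (e v : ℕ))
      (Fin.val_injective.comp e.injective) (fun u v h => h.elim), rfl⟩

/-- A linear forest splits the vertices into lists that trace its components. -/
theorem IsLinearForest.exists_chains [Fintype V] {F : SimpleGraph V} (hF : F.IsLinearForest) :
    ∃ L : List (List V), [] ∉ L ∧ (∀ l ∈ L, l.IsChain F.Adj) ∧ L.flatten.Nodup ∧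
      (∀ v, v ∈ L.flatten) ∧ L.length + F.edgeSet.ncard ≤ Fintype.card V := by
  classical
  choose n he using hF.2
  let e : ∀ c : F.ConnectedComponent, c.toSimpleGraph ≃g pathGraph (n c) := fun c => (he c).some
  let l : F.ConnectedComponent → List V := fun c => List.ofFn fun i => ((e c).symm i).1
  have hcomp : ∀ c i, F.connectedComponentMk ((e c).symm i).1 = c := fun c i => ((e c).symm i).2
  have hmem : ∀ c v, v ∈ l c ↔ F.connectedComponentMk v = c := by
    intro c v
    rw [List.mem_ofFn]
    exact ⟨by rintro ⟨i, rfl⟩; exact hcomp c i, fun h => ⟨e c ⟨v, h⟩, by simp⟩⟩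
  have hpos : ∀ c, 0 < n c := by
    intro c
    obtain ⟨v, hv⟩ := c.nonempty_supp
    exact (e c ⟨v, hv⟩).pos
  refine ⟨(Finset.univ : Finset F.ConnectedComponent).toList.map l, ?_, ?_, ?_, ?_, ?_⟩
  · intro h
    obtain ⟨c, -, hc⟩ := List.mem_map.1 h
    have := congrArg List.length hc
    have := hpos c
    simp [l] at *
    omega
  · intro l' h
    obtain ⟨c, -, rfl⟩ := List.mem_map.1 h
    rw [List.isChain_iff_getElem]
    intro i hi
    simp only [l, List.getElem_ofFn]
    have : c.toSimpleGraph.Adj ((e c).symm ⟨i, by simp [l] at hi; omega⟩)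
      ((e c).symm ⟨i + 1, by simpa [l] using hi⟩) := by
      rw [Iso.map_adj_iff, pathGraph_adj]
      simp
    exact this
  · rw [List.nodup_flatten]
    constructor
    · intro l' h
      obtain ⟨c, -, rfl⟩ := List.mem_map.1 h
      exact List.nodup_ofFn.2 (Subtype.val_injective.comp (e c).symm.injective)
    · rw [List.pairwise_map]
      refine (Finset.nodup_toList _).imp ?_
      intro a b hab v ha hb
      exact hab (((hmem _ _).1 ha).symm.trans ((hmem _ _).1 hb))
  · intro v
    rw [List.mem_flatten]
    exact ⟨l (F.connectedComponentMk v), List.mem_map.2 ⟨_, by simp, rfl⟩, (hmem _ _).2 rfl⟩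
  -- Each edge is charged to its later endpoint on its path, each component to its first vertex. At
  -- `idx v = 0` the truncated subtraction makes `pre v = v`, which no edge uses.
  · let idx : V → ℕ := fun v => (e (F.connectedComponentMk v) ⟨v, rfl⟩ : ℕ)
    let pre : V → V := fun v => ((e (F.connectedComponentMk v)).symm
      ⟨idx v - 1, lt_of_le_of_lt (Nat.sub_le _ _) (Fin.is_lt _)⟩).1
    have hidx : ∀ c i, idx ((e c).symm i).1 = i := by
      intro c i
      have : ∀ c' (h : F.connectedComponentMk ((e c).symm i).1 = c'), c' = c →
          (e c' ⟨((e c).symm i).1, h⟩ : ℕ) = i := by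
        rintro c' h rfl
        exact congrArg Fin.val ((e _).apply_symm_apply i)
      exact this _ rfl (hcomp c i)
    have hpre : ∀ u v, F.Adj u v → idx u + 1 = idx v → pre v = u := by
      intro u v huv h
      have hc : F.connectedComponentMk u = F.connectedComponentMk v :=
        ConnectedComponent.sound huv.reachable
      have : ∀ c' (hu : F.connectedComponentMk u = c') (hv : F.connectedComponentMk v = c') (i : Fin (n c')),
          (i : ℕ) = (e _ ⟨u, rfl⟩ : Fin (n (F.connectedComponentMk u))) → ((e c').symm i).1 = u := by
        rintro c' rfl hv i hi
        rw [Fin.ext hi]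
        simp
      exact this _ hc rfl _ (by simp only [idx] at h ⊢; omega)
    have hcons : ∀ u v, F.Adj u v → idx u + 1 = idx v ∨ idx v + 1 = idx u := by
      intro u v huv
      have hc : F.connectedComponentMk u = F.connectedComponentMk v :=
        ConnectedComponent.sound huv.reachable
      have : ∀ c' (hu : F.connectedComponentMk u = c') (hv : F.connectedComponentMk v = c'),
          (e c' ⟨u, hu⟩ : ℕ) = idx u ∧ (e c' ⟨v, hv⟩ : ℕ) = idx v := by
        rintro c' hu hv
        constructor
        · subst hu; rfl
        · subst hv; rfl
      obtain ⟨h1, h2⟩ := this _ hc rfl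
      rw [← h1, ← h2, ← pathGraph_adj, Iso.map_adj_iff]
      exact huv
    have h1 : F.edgeSet.ncard ≤ #{v | ¬ idx v = 0} := by
      rw [← Set.ncard_coe_finset]
      refine (Set.ncard_le_ncard ?_ (Set.toFinite _)).trans
        (Set.ncard_image_le (f := fun v => s(pre v, v)) (Set.toFinite _))
      intro x
      induction x with | _ u v
      intro huv
      rw [mem_edgeSet] at huv
      rcases hcons u v huv with h | h
      · exact ⟨v, by simp; omega, by simp only [hpre u v huv h]⟩
      · exact ⟨u, by simp; omega, by simp only [hpre v u huv.symm h, Sym2.eq_swap]⟩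
    have h2 : Fintype.card F.ConnectedComponent ≤ #{v | idx v = 0} := by
      refine Finset.card_le_card_of_injOn (fun c => ((e c).symm ⟨0, hpos c⟩).1) ?_ ?_
      · intro c _
        simp [hidx]
      · intro a _ b _ h
        rw [← hcomp a ⟨0, hpos a⟩, ← hcomp b ⟨0, hpos b⟩]
        exact congrArg _ h
    have h3 := Finset.card_filter_add_card_filter_not (s := (Finset.univ : Finset V)) (fun v => idx v = 0)
    simp only [List.length_map, Finset.length_toList, Finset.card_univ] at *
    omega

end SimpleGraph
-- Traceability of the product: necessity, then sufficiency.
namespace SimpleGraph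
variable {V : Type*}

theorem isTraceable_of_isChain [DecidableEq V] {G : SimpleGraph V} {l : List V} (hne : l ≠ [])
    (hch : l.IsChain G.Adj) (hnd : l.Nodup) (hmem : ∀ v, v ∈ l) : G.IsTraceable := by
  refine ⟨_, _, Walk.ofSupport l hne hch, fun v => ?_⟩
  rw [Walk.support_ofSupport]
  exact List.count_eq_one_of_mem hnd (hmem v)

theorem IsTraceable.card_sub_one_le [Fintype V] [DecidableEq V] [Nonempty V] {H : SimpleGraph V}
    {k : ℕ} (h : ((pathGraph (2 * k + 1)).lexProduct H).IsTraceable) :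
    Fintype.card V ≤ (k + 1) * H.maxLinearForest + 1 := by
  obtain ⟨u, w, p, hp⟩ := h
  have hlen : p.length + 1 = (2 * k + 1) * Fintype.card V := by
    rw [← Walk.length_support, hp.length_support]; simp
  have hinj := hp.isPath.getVert_injOn
  have hsurj : ∀ x, ∃ t ≤ p.length, p.getVert t = x := by
    intro x
    obtain ⟨t, ht, htl⟩ := Walk.mem_support_iff_exists_getVert.1 (hp.mem_support x)
    exact ⟨t, htl, ht⟩
  choose idx hidx_le hidx using hsurj
  have hidx_inj : Function.Injective idx := fun x y h => by rw [← hidx x, ← hidx y, h]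
  have hidx_get : ∀ t ≤ p.length, idx (p.getVert t) = t := fun t ht =>
    hinj (hidx_le _) ht (hidx _)
  let F : Fin (2 * k + 1) → SimpleGraph V := fun i =>
    { Adj := fun a b => H.Adj a b ∧ (idx (i, b) = idx (i, a) + 1 ∨ idx (i, a) = idx (i, b) + 1)
      symm := ⟨fun _ _ h => ⟨h.1.symm, h.2.symm⟩⟩
      loopless := ⟨fun _ h => h.1.ne rfl⟩ }
  have hF : ∀ i, (F i).edgeSet.ncard ≤ H.maxLinearForest := fun i =>
    IsLinearForest.ncard_le (isLinearForest_of_consecutive (f := fun v => idx (i, v))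
      (fun a b h => congrArg Prod.snd (hidx_inj h)) (fun a b h => h.2)) (fun a b h => h.1)
  let c : ℕ → ℕ := fun t => ((p.getVert t).1 : ℕ)
  have hck : ∀ t, c t < 2 * k + 1 := fun t => (p.getVert t).1.2
  -- Changing column changes parity, so these steps stay within one even column.
  let T := {t ∈ range p.length | c t % 2 = 0 ∧ c (t + 1) % 2 = 0}
  have hT : #T ≤ H.maxLinearForest * #(range (k + 1)) := by
    refine Finset.card_le_mul_card_image_of_maps_to (f := fun t => c t / 2) ?_ _ ?_
    · intro t _
      have := hck t
      simp
      omega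
    · intro j hj
      rw [Finset.mem_range] at hj
      refine le_trans ?_ (hF ⟨2 * j, by omega⟩)
      rw [← Set.ncard_coe_finset]
      have key : ∀ t, t ∈ T → c t / 2 = j → t < p.length ∧
          p.getVert t = (⟨2 * j, by omega⟩, (p.getVert t).2) ∧
          p.getVert (t + 1) = (⟨2 * j, by omega⟩, (p.getVert (t + 1)).2) ∧
          H.Adj (p.getVert t).2 (p.getVert (t + 1)).2 := by
        intro t ht hj
        simp only [T, Finset.mem_filter, Finset.mem_range] at ht
        obtain ⟨htl, h1, h2⟩ := ht
        rcases p.adj_getVert_succ htl with h | h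
        · rw [pathGraph_adj] at h
          simp only [c] at *
          omega
        · have := congrArg Fin.val h.1
          refine ⟨htl, Prod.ext (Fin.ext ?_) rfl, Prod.ext (Fin.ext ?_) rfl, h.2⟩
          · simp only [c] at *; omega
          · simp only [c] at *; omega
      refine Set.ncard_le_ncard_of_injOn (fun t => s((p.getVert t).2, (p.getVert (t + 1)).2)) ?_ ?_
        (Set.toFinite _)
      · intro t ht
        simp only [Finset.coe_filter, Set.mem_ofPred_eq] at ht
        obtain ⟨htl, h1, h2, h3⟩ := key t ht.1 ht.2
        refine ⟨h3, Or.inl ?_⟩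
        rw [← h1, ← h2, hidx_get _ htl, hidx_get _ htl.le]
      · intro t ht s hs hts
        simp only [Finset.coe_filter, Set.mem_ofPred_eq] at ht hs
        obtain ⟨htl, h1, h2, h3⟩ := key t ht.1 ht.2
        obtain ⟨hsl, g1, g2, g3⟩ := key s hs.1 hs.2
        rw [Sym2.eq_iff] at hts
        rcases hts with ⟨h, -⟩ | ⟨h, h'⟩
        · rw [h, ← g1] at h1
          exact hinj htl.le hsl.le h1
        -- The same edge traversed in reverse would give `t = s + 1` and `s = t + 1`.
        · rw [h, ← g2] at h1
          rw [h', ← g1] at h2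
          have a1 := hinj htl.le hsl h1
          have a2 := hinj htl hsl.le h2
          omega
  -- Used with `g` the identity and the successor: steps that start, or end, in an odd column.
  have hodd : ∀ g : ℕ → ℕ, Function.Injective g → (∀ t < p.length, g t ≤ p.length) →
      #{t ∈ range p.length | c (g t) % 2 = 1} ≤ k * Fintype.card V := by
    intro g hg hgl
    have : k * Fintype.card V = #(range k ×ˢ (univ : Finset V)) := by simp
    rw [this]
    refine Finset.card_le_card_of_injOn (fun t => (c (g t) / 2, (p.getVert (g t)).2)) ?_ ?_
    · intro t ht
      simp only [Finset.coe_filter, Set.mem_ofPred_eq] at ht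
      have := hck (g t)
      simp
      omega
    · intro t ht s hs hts
      simp only [Finset.coe_filter, Set.mem_ofPred_eq, Finset.mem_range] at ht hs
      simp only [Prod.mk.injEq] at hts
      apply hg
      refine hinj (hgl t ht.1) (hgl s hs.1) (Prod.ext (Fin.ext ?_) hts.2)
      simp only [c] at *
      omega
  have hcover : range p.length ⊆ T ∪ ({t ∈ range p.length | c t % 2 = 1} ∪
      {t ∈ range p.length | c (t + 1) % 2 = 1}) := by
    intro t ht
    simp only [T, Finset.mem_union, Finset.mem_filter, ht, true_and]
    omega
  have h0 := (Finset.card_le_card hcover).trans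
    ((Finset.card_union_le _ _).trans (Nat.add_le_add_left (Finset.card_union_le _ _) _))
  have h1 := hodd id (fun _ _ h => h) (fun t ht => ht.le)
  have h2 := hodd (· + 1) (fun _ _ h => by simpa using h) (fun t ht => ht)
  simp only [Finset.card_range, id] at h0 h1 h2 hT
  have e1 : (2 * k + 1) * Fintype.card V = 2 * (k * Fintype.card V) + Fintype.card V := by ring
  have e2 := mul_comm H.maxLinearForest (k + 1)
  omega

theorem isTraceable_of_card_sub_one_le [Fintype V] [DecidableEq V] [Nonempty V]
    {H : SimpleGraph V} {k : ℕ} (h : Fintype.card V ≤ (k + 1) * H.maxLinearForest + 1) :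
    ((pathGraph (2 * k + 1)).lexProduct H).IsTraceable := by
  obtain ⟨F, hFH, hF, hcard⟩ := H.exists_isLinearForest_ncard_eq
  obtain ⟨L₀, hne₀, hch₀, hnd₀, hmem₀, hlen₀⟩ := hF.exists_chains
  rw [hcard] at hlen₀
  set n := Fintype.card V with hn
  have hn0 : 0 < n := Fintype.card_pos
  have hfl₀ : L₀.flatten.length = n := by
    rw [← List.toFinset_card_of_nodup hnd₀, hn, ← Finset.card_univ]
    congr 1
    ext v
    simpa using hmem₀ v
  -- This is where `h` enters: `(k + 1)(n - π(H)) ≤ kn + 1`.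
  have hb : (k + 1) * L₀.length ≤ k * n + 1 := by
    have := Nat.mul_le_mul_left (k + 1) hlen₀
    rw [mul_add, Nat.succ_mul k n] at this
    omega
  obtain ⟨c, hc, hsum⟩ := Nat.exists_sum_range_eq (K := k + 1) (s := k * n + 1) (p := L₀.length)
    (n := n) hb (by rw [Nat.succ_mul]; omega) (by omega)
  choose L hne hch hfl hlen using fun i => List.exists_refinement L₀ hne₀
    (fun l hl => (hch₀ l hl).imp fun a b hab => hFH hab) (hc i).1 (by rw [hfl₀]; exact (hc i).2)
  let G := (pathGraph (2 * k + 1)).lexProduct H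
  let f : ℕ → List (List (Fin (2 * k + 1) × V)) := fun i =>
    (L i).map (List.map fun v => (Fin.ofNat _ (2 * i), v))
  let g : ℕ → List (Fin (2 * k + 1) × V) := fun i =>
    L₀.flatten.map fun v => (Fin.ofNat _ (2 * i + 1), v)
  have hflen : ∀ i, (f i).length = c i := fun i => by simp [f, hlen]
  have hglen : ∀ i, (g i).length = n := fun i => by simp only [g, List.length_map, hfl₀]
  have hf_fst : ∀ i < k + 1, ∀ e ∈ f i, ∀ x ∈ e, (x.1 : ℕ) = 2 * i := by
    intro i hi e he x hx
    obtain ⟨l, -, rfl⟩ := List.mem_map.1 he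
    obtain ⟨v, -, rfl⟩ := List.mem_map.1 hx
    exact Nat.mod_eq_of_lt (by omega)
  have hg_fst : ∀ i < k, ∀ x ∈ g i, (x.1 : ℕ) = 2 * i + 1 := by
    intro i hi x hx
    obtain ⟨v, -, rfl⟩ := List.mem_map.1 hx
    exact Nat.mod_eq_of_lt (by omega)
  let es := (List.range (k + 1)).flatMap f
  let os := (List.range k).flatMap g
  have hes : es.length = k * n + 1 := by
    rw [← hsum, List.length_flatMap, Finset.sum_range]
    simp only [hflen, ← Finset.sum_range]
    rfl
  have hos : os.length = k * n := by
    simp only [os, List.length_flatMap, hglen]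
    simp
  -- Columns from `2i` on hold at most `(k + 1 - i)n` of the `kn + 1` blocks, so at least `(i - 1)n
  -- + 1` come earlier.
  have hlow : ∀ i < k + 1, i * n ≤ ∑ j ∈ range i, (f j).length + n - 1 := by
    intro i hi
    simp only [hflen]
    have h1 := Finset.sum_range_add_sum_Ico c (Nat.le_of_lt hi)
    have h2 : ∑ j ∈ Ico i (k + 1), c j ≤ (k + 1 - i) * n := by
      simpa using Finset.sum_le_card_nsmul (Ico i (k + 1)) c n fun j _ => (hc j).2
    have h3 : i * n + (k + 1 - i) * n = k * n + n := by
      rw [← add_mul, Nat.add_sub_cancel' (Nat.le_of_lt hi), Nat.succ_mul]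
    omega
  have hup : ∀ i, ∑ j ∈ range (i + 1), (f j).length ≤ (i + 1) * n := by
    intro i
    simp only [hflen]
    simpa using Finset.sum_le_card_nsmul (range (i + 1)) c n fun j _ => (hc j).2
  have hgsum : ∀ i, ∑ j ∈ range i, (g j).length = i * n := fun i => by simp [hglen]
  have hadj : ∀ x y : Fin (2 * k + 1) × V,
      (x.1 : ℕ) + 1 = y.1 ∨ (y.1 : ℕ) + 1 = x.1 → G.Adj x y := fun x y hxy =>
    Or.inl (pathGraph_adj.2 hxy)
  -- blocks and separators at nearby positions lie in neighbouring columns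
  have key : ∀ (m m' : ℕ) (ho : m < os.length) (he : m' < es.length), m ≤ m' → m' ≤ m + 1 →
      ∀ x ∈ es[m'], (x.1 : ℕ) + 1 = os[m].1 ∨ (os[m].1 : ℕ) + 1 = x.1 := by
    intro m m' ho he h1 h2 x hx
    obtain ⟨i, hi, hmi, hi1, hi2⟩ := List.getElem_flatMap_range f (k + 1) m' he
    obtain ⟨j, hj, hmj, hj1, hj2⟩ := List.getElem_flatMap_range g k m ho
    rw [hf_fst i hi _ hmi x hx, hg_fst j hj _ hmj]
    rw [hgsum] at hj1 hj2
    have h3 := hup i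
    have h4 := hlow i hi
    have h5 : j < i + 1 := lt_of_mul_lt_mul_right (a := n) (by omega) (Nat.zero_le _)
    have h6 : i < j + 2 := by
      refine lt_of_mul_lt_mul_right (a := n) ?_ (Nat.zero_le _)
      rw [show (j + 2) * n = (j + 1) * n + n by ring]
      omega
    omega
  have hes_chain : ∀ e ∈ es, e.IsChain G.Adj := by
    intro e he
    obtain ⟨i, -, hi⟩ := List.mem_flatMap.1 he
    obtain ⟨l, hl, rfl⟩ := List.mem_map.1 hi
    rw [List.isChain_map]
    exact (hch i l hl).imp fun a b hab => Or.inr ⟨rfl, hab⟩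
  have hes_ne : [] ∉ es := by
    intro he
    obtain ⟨i, -, hi⟩ := List.mem_flatMap.1 he
    obtain ⟨l, hl, hl'⟩ := List.mem_map.1 hi
    rw [List.map_eq_nil_iff] at hl'
    exact hne i (hl' ▸ hl)
  obtain ⟨l, hperm, hchain, -⟩ := List.exists_isChain_perm_flatten_append (R := G.Adj) os es
    (by omega) hes_chain hes_ne (fun m ho he x hx => hadj _ _ (key m m ho he le_rfl (by omega) x hx))
    (fun m ho he x hx => (hadj _ _ (key m (m + 1) ho he (by omega) le_rfl x hx)).symm)
  have hmem : ∀ x, x ∈ l := by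
    rintro ⟨a, v⟩
    rw [hperm.mem_iff, List.mem_append]
    have ha := a.2
    rcases Nat.even_or_odd' (a : ℕ) with ⟨i, hi | hi⟩
    · left
      have : v ∈ (L i).flatten := by rw [hfl]; exact hmem₀ v
      obtain ⟨e, he, hv⟩ := List.mem_flatten.1 this
      refine List.mem_flatten.2 ⟨_, List.mem_flatMap.2 ⟨i, by simp; omega,
        List.mem_map.2 ⟨e, he, rfl⟩⟩, List.mem_map.2 ⟨v, hv, ?_⟩⟩
      rw [← hi]; simp
    · right
      refine List.mem_flatMap.2 ⟨i, by simp; omega, List.mem_map.2 ⟨v, hmem₀ v, ?_⟩⟩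
      rw [← hi]; simp
  have hflat : es.flatten.length = (k + 1) * n := by
    have : ∀ i, (f i).flatten.length = n := by
      intro i
      simp only [f, ← List.map_flatten, List.length_map, hfl, hfl₀]
    have h' : ∀ K, ((List.range K).flatMap f).flatten.length = K * n := by
      intro K
      induction K with
      | zero => simp
      | succ K ih =>
        rw [List.range_succ, List.flatMap_append, List.flatten_append, List.length_append, ih,
          List.flatMap_singleton, this, Nat.succ_mul]
    exact h' _
  -- `l` reaches every vertex and has exactly as many entries as there are vertices.
  have hnd : l.Nodup := by
    have h1 : l.toFinset = univ := by ext x; simpa using hmem x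
    have h2 : l.length = Fintype.card (Fin (2 * k + 1) × V) := by
      rw [hperm.length_eq, List.length_append, hflat, hos]
      simp [← hn]
      ring
    rw [← Multiset.coe_nodup, ← Multiset.toFinset_card_eq_card_iff_nodup]
    simpa [h2] using congrArg Finset.card h1
  refine isTraceable_of_isChain ?_ hchain hnd hmem
  rintro rfl
  obtain ⟨v⟩ := ‹Nonempty V›
  simpa using hmem (0, v)

end SimpleGraph

theorem theorem5 {V : Type*} [Fintype V] [DecidableEq V] [Nonempty V] (H : SimpleGraph V)
    (k : ℕ) (hk : 1 ≤ k) :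
    (0 < H.maxLinearForest →
      (((SimpleGraph.pathGraph (2 * k + 1)).lexProduct H).IsTraceable ↔
        ⌈((Fintype.card V : ℚ) - 1) / (H.maxLinearForest : ℚ)⌉ ≤ (k : ℤ) + 1)) ∧
    (((SimpleGraph.pathGraph (2 * k + 1)).lexProduct H).IsTraceable ↔
      (Fintype.card V : ℤ) - 1 ≤ ((k : ℤ) + 1) * (H.maxLinearForest : ℤ)) := by
  have main : ((SimpleGraph.pathGraph (2 * k + 1)).lexProduct H).IsTraceable ↔
      (Fintype.card V : ℤ) - 1 ≤ ((k : ℤ) + 1) * (H.maxLinearForest : ℤ) := by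
    rw [sub_le_iff_le_add]
    constructor
    · intro h
      exact_mod_cast h.card_sub_one_le
    · intro h
      exact SimpleGraph.isTraceable_of_card_sub_one_le (by exact_mod_cast h)
  refine ⟨fun h => ?_, main⟩
  rw [main, Int.ceil_le, div_le_iff₀ (by exact_mod_cast h)]
  exact_mod_cast Iff.rfl
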